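/- Let $[2]^*$ be the set of finite words over $\{1,2\}$ (compositions with parts at most $2$), ordered by $u\le w$ if and only if $w$ has a subword $w(i_1)\cdots w(i_l)$, $i_1<\cdots<i_l$, with $l$ the length of $u$ and $u(j)\le w(i_j)$ for $1\le j\le l$. Let $\zeta$ be the zeta function of this poset, $\zeta^m$ its $m$-th convolution power in the incidence algebra over $\mathbb{Z}$ ($\zeta^0$ is the identity), and $|w|$ the sum of the letters of $w$. A word has type $(l_1,l_2)$ if it contains exactly $l_1$ ones and $l_2$ twos. Let $f$ be the continuous ring endomorphism of $\mathbb{Z}[[x_1,x_2]]$ with $$f(x_1)=x_1+x_2,\qquad f(x_2)=\frac{x_2}{1-x_1},$$ and for $m\ge 0$ let $a_m(x),b_m(x)\in\mathbb{Z}[[x]]$ be obtained from the iterates $f^m(x_1)$ and $f^m(x_2)$, respectively, by the substitution $x_1=x$, $x_2=x^2$. **Theorem.** If $u\in[2]^*$ has type $(l_1,l_2)$, then for all $m\ge0$, as formal power series over $\mathbb{Z}$, $$\sum_{w\in[2]^*}\zeta^m(u,w)\,x^{|w|}=a_m(x)^{l_1}\,b_m(x)^{l_2}\prod_{i=0}^{m-1}\frac{1}{1-a_i(x)-b_i(x)}.$$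 Furthermore, for all $m\ge 0$, $$a_m(x)=\frac{x\,\bar a_m(x)}{d_m(x)}\qquad\text{and}\qquad b_m(x)=\frac{x^2}{d_m(x)\,d_{m+1}(x)},$$ where $$\bar a_m(x)=\sum_{i\ge0}(-1)^{\lfloor i/2\rfloor}\binom{\lfloor (m+i)/2\rfloor}{i}x^i,\qquad d_m(x)=\sum_{i\ge0}(-1)^{\lceil i/2\rceil}\binom{\lfloor (m+i-1)/2\rfloor}{i}x^i,$$ with the conventions that $\binom{N}{0}=1$ for every integer $N$ and $\binom{N}{k}=0$ for $k>N$, $k\ge 1$. All denominators above are invertible in $\mathbb{Z}[[x]]$. -/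

import Mathlib

open scoped PowerSeries.WithPiTopology

namespace CompPoset

/-- Words over the alphabet `{1, …, n}`, that is, integer compositions with all parts at most `n`.
The element `k : Fin n` is the letter `k + 1`. -/
def Word (n : ℕ) : Type := List (Fin n)

instance (n : ℕ) : DecidableEq (Word n) := inferInstanceAs (DecidableEq (List (Fin n)))

/-- The sum of the parts of a composition. -/
def Word.norm {n : ℕ} (w : Word n) : ℕ := (List.map (fun k : Fin n => (k : ℕ) + 1) w).sum

/-- The type of a word: for every letter, the number of its occurrences. -/
def Word.type {n : ℕ} (w : Word n) : Fin n → ℕ := fun k => List.count k w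

/-- Composition order: `u ≤ w` if and only if `w` has a subword of the same length as `u` that
dominates `u` letter by letter. -/
instance (n : ℕ) : LE (Word n) :=
  ⟨fun u w => ∃ v : List (Fin n), List.Forall₂ (· ≤ ·) u v ∧ List.Sublist v w⟩

theorem Word.le_iff {n : ℕ} (u w : Word n) :
    u ≤ w ↔ List.SublistForall₂ (fun i j : Fin n => i ≤ j) u w :=
  List.sublistForall₂_iff.symm

theorem Word.length_le {n : ℕ} {u w : Word n} (h : u ≤ w) :
    List.length u ≤ List.length w := by
  obtain ⟨v, h1, h2⟩ := h
  exact h1.length_eq ▸ h2.length_le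

theorem forall₂_antisymm {n : ℕ} {u v : List (Fin n)} (h : List.Forall₂ (· ≤ ·) u v)
    (h' : List.Forall₂ (· ≤ ·) v u) : u = v := by
  induction h with
  | nil => rfl
  | cons hab _ ih =>
    cases h' with
    | cons hba h'' => rw [le_antisymm hab hba, ih h'']

instance (n : ℕ) : PartialOrder (Word n) where
  le_refl u := (Word.le_iff u u).2 (refl_of (List.SublistForall₂ (fun i j : Fin n => i ≤ j)) u)
  le_trans u v w h h' :=
    (Word.le_iff u w).2 (trans_of (List.SublistForall₂ (fun i j : Fin n => i ≤ j))
      ((Word.le_iff u v).1 h) ((Word.le_iff v w).1 h'))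
  le_antisymm u w h h' := by
    have hl := le_antisymm (Word.length_le h) (Word.length_le h')
    obtain ⟨v, h1, h2⟩ := h
    obtain ⟨v', h1', h2'⟩ := h'
    have e : v = w := h2.eq_of_length (by rw [← h1.length_eq, hl])
    have e' : v' = u := h2'.eq_of_length (by rw [← h1'.length_eq, hl])
    subst e e'
    exact forall₂_antisymm h1 h1'

noncomputable instance (n : ℕ) : LocallyFiniteOrder (Word n) :=
  LocallyFiniteOrder.ofFiniteIcc fun _ w =>
    (List.finite_length_le (Fin n) (List.length w)).subset fun _ hv => Word.length_le hv.2

/-- The zeta function of the poset `Word n`, in its incidence algebra over `ℤ` (in which the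
product is convolution). -/
noncomputable def zeta (n : ℕ) : IncidenceAlgebra ℤ (Word n) :=
  open scoped Classical in IncidenceAlgebra.zeta ℤ

/-- The power series `(x_k + ⋯ + x_n) / (1 - x_1 - ⋯ - x_{k-1})`; its denominator is a unit by
`isUnit_denominator`. -/
noncomputable def image (n : ℕ) (k : Fin n) : MvPowerSeries (Fin n) ℤ :=
  (∑ j ∈ Finset.univ.filter (fun j => k ≤ j), MvPowerSeries.X j) *
    Ring.inverse (1 - ∑ j ∈ Finset.univ.filter (fun j => j < k), MvPowerSeries.X j)

theorem isUnit_denominator (n : ℕ) (k : Fin n) :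
    IsUnit (1 - ∑ j ∈ Finset.univ.filter (fun j => j < k), MvPowerSeries.X j :
      MvPowerSeries (Fin n) ℤ) := by
  rw [MvPowerSeries.isUnit_iff_constantCoeff]
  simp [map_sum]

theorem image_hasSubst (n : ℕ) : MvPowerSeries.HasSubst (image n) :=
  MvPowerSeries.hasSubst_of_constantCoeff_zero fun k => by simp [image, map_sum]

/-- The endomorphism `f` of `ℤ⟦x_1, …, x_n⟧` that substitutes
`(x_k + ⋯ + x_n) / (1 - x_1 - ⋯ - x_{k-1})` for every `x_k`. -/
noncomputable def f (n : ℕ) : MvPowerSeries (Fin n) ℤ →ₐ[ℤ] MvPowerSeries (Fin n) ℤ :=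
  MvPowerSeries.substAlgHom (image_hasSubst n)

theorem normSubst_hasSubst (n : ℕ) :
    MvPowerSeries.HasSubst (fun k : Fin n => (PowerSeries.X ^ ((k : ℕ) + 1) : PowerSeries ℤ)) :=
  MvPowerSeries.hasSubst_of_constantCoeff_zero fun k => by
    change PowerSeries.constantCoeff (PowerSeries.X ^ ((k : ℕ) + 1) : PowerSeries ℤ) = 0
    simp

/-- The norm substitution `x_k ↦ x ^ k`. -/
noncomputable def normSubst (n : ℕ) : MvPowerSeries (Fin n) ℤ →ₐ[ℤ] PowerSeries ℤ :=
  MvPowerSeries.substAlgHom (normSubst_hasSubst n)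

/-- `a_m(x)`: for `n = 2`, the `m`-th iterate of `f` at the first variable, after the norm
substitution. -/
noncomputable def a (m : ℕ) : PowerSeries ℤ :=
  normSubst 2 ((f 2)^[m] (MvPowerSeries.X 0))

/-- `b_m(x)`: for `n = 2`, the `m`-th iterate of `f` at the second variable, after the norm
substitution. -/
noncomputable def b (m : ℕ) : PowerSeries ℤ :=
  normSubst 2 ((f 2)^[m] (MvPowerSeries.X 1))

/-- The binomial coefficient, with the convention that it is `1` for `k = 0` and any `N`, and
`0` for `k < 0` and for `0 ≠ k > N`. -/
def binom (N k : ℤ) : ℤ :=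
  if k = 0 then 1 else if k < 0 ∨ N < k then 0 else (N.toNat.choose k.toNat : ℤ)

/-- `∑_i (-1)^⌊i/2⌋ binom(⌊(m+i)/2⌋, i) x^i`. Division in `ℤ` by `2` rounds down. -/
noncomputable def aBar (m : ℕ) : PowerSeries ℤ :=
  PowerSeries.mk fun i => (-1) ^ (i / 2) * binom (((m : ℤ) + i) / 2) i

/-- `∑_i (-1)^⌈i/2⌉ binom(⌊(m+i-1)/2⌋, i) x^i`. -/
noncomputable def d (m : ℕ) : PowerSeries ℤ :=
  PowerSeries.mk fun i => (-1) ^ ((i + 1) / 2) * binom (((m : ℤ) + i - 1) / 2) i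

end CompPoset

namespace CompPoset
open PowerSeries

/-! Give the letters weights `c k` divisible by `X`. Splitting words by their first letter turns the
sum of `weight c w` over `w ≥ u` into linear equations. Their solution is the weight of `u` under
the substitution defining `f`, times `1 / (1 - ∑ c j)` (`hasSum_weight_of_le`). Since `ζ^(m+1) = ζ *
ζ^m`, each further factor `ζ` sends the weights `(a m, b m)` to `(a (m+1), b (m+1))` and contributes
one factor to the product (`hasSum_zeta_pow`). For the closed forms, Pascal's rule gives linear
recurrences for `aBar` and `d`. The identity `aBar_succ_mul_d` then matches `a (m+1) - a m = b m`,
while `d (m+2) = d m * (1 - a m)` matches `b (m+1) * (1 - a m) = b m`. -/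

theorem a_zero : a 0 = X := by
  rw [a, Function.iterate_zero_apply, normSubst, MvPowerSeries.substAlgHom_X]
  exact pow_one X

theorem b_zero : b 0 = X ^ 2 := by
  rw [b, Function.iterate_zero_apply, normSubst, MvPowerSeries.substAlgHom_X]
  rfl

theorem f_X_zero : f 2 (MvPowerSeries.X 0) = MvPowerSeries.X 0 + MvPowerSeries.X 1 := by
  rw [f, MvPowerSeries.substAlgHom_X]
  simp [image]

theorem f_X_one :
    f 2 (MvPowerSeries.X 1) * (1 - MvPowerSeries.X 0) = MvPowerSeries.X 1 := by
  have h := isUnit_denominator 2 1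
  have e : Finset.univ.filter (fun j : Fin 2 => j < 1) = {0} := by decide
  have e' : Finset.univ.filter (fun j : Fin 2 => 1 ≤ j) = {1} := by decide
  rw [e, Finset.sum_singleton] at h
  rw [f, MvPowerSeries.substAlgHom_X, image, e, e', Finset.sum_singleton, Finset.sum_singleton,
    mul_assoc, Ring.inverse_mul_cancel _ h, mul_one]

/-- Reading `f^(m+1)` as `f^m ∘ f` carries the formula for `f` at a variable through a ring
homomorphism. -/
theorem a_succ (m : ℕ) : a (m + 1) = a m + b m := by
  rw [a, Function.iterate_succ_apply, f_X_zero, iterate_map_add, map_add, a, b]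

theorem b_succ_mul (m : ℕ) : b (m + 1) * (1 - a m) = b m := by
  have h := congrArg (fun p => normSubst 2 ((f 2)^[m] p)) f_X_one
  simpa only [iterate_map_mul, iterate_map_sub, iterate_map_one, map_mul, map_sub, map_one,
    ← Function.iterate_succ_apply, a, b] using h

theorem isUnit_one_sub_of_X_dvd {R : Type*} [CommRing R] {p : R⟦X⟧} (h : X ∣ p) :
    IsUnit (1 - p) := by
  rw [isUnit_iff_constantCoeff, map_sub, X_dvd_iff.1 h]
  simp

theorem X_dvd_a_and_b (m : ℕ) : X ∣ a m ∧ X ∣ b m := by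
  induction m with
  | zero => exact ⟨a_zero ▸ dvd_rfl, b_zero ▸ dvd_pow_self _ two_ne_zero⟩
  | succ m ih =>
    refine ⟨a_succ m ▸ dvd_add ih.1 ih.2, ?_⟩
    exact (isUnit_one_sub_of_X_dvd ih.1).dvd_mul_right.1 (b_succ_mul m ▸ ih.2)

theorem b_succ (m : ℕ) : b (m + 1) = b m * Ring.inverse (1 - a m) := by
  rw [← b_succ_mul m, mul_assoc,
    Ring.mul_inverse_cancel _ (isUnit_one_sub_of_X_dvd (X_dvd_a_and_b m).1), mul_one]

/-! ### Closed forms: the binomial series `aBar` and `d` -/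

theorem binom_zero_right (N : ℤ) : binom N 0 = 1 := by simp [binom]

theorem binom_eq_zero_of_lt {N k : ℤ} (hk : k ≠ 0) (h : N < k) : binom N k = 0 := by
  simp [binom, hk, h]

theorem binom_natCast (N k : ℕ) : binom N k = N.choose k := by
  rcases Nat.eq_zero_or_pos k with rfl | hk
  · simp [binom]
  · rcases lt_or_ge N k with h | h
    · rw [binom_eq_zero_of_lt (by omega) (by omega), Nat.choose_eq_zero_of_lt h, Nat.cast_zero]
    · simp [binom, hk.ne', h]

theorem aBar_add_two (m : ℕ) : aBar (m + 2) = aBar m + X * d (m + 2) := by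
  ext i
  cases i with
  | zero => simp [aBar, binom_zero_right]
  | succ i =>
    have h1 : (((m + 2 : ℕ) : ℤ) + (i + 1 : ℕ)) / 2 = (((m + i + 1) / 2 + 1 : ℕ) : ℤ) := by omega
    have h2 : ((m : ℤ) + (i + 1 : ℕ)) / 2 = (((m + i + 1) / 2 : ℕ) : ℤ) := by omega
    have h3 : (((m + 2 : ℕ) : ℤ) + i - 1) / 2 = (((m + i + 1) / 2 : ℕ) : ℤ) := by omega
    simp only [aBar, d, map_add, coeff_mk, coeff_succ_X_mul, h1, h2, h3, binom_natCast]
    rw [Nat.choose_succ_succ]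
    push_cast
    ring

theorem d_add_two (m : ℕ) : d (m + 2) = d m - X * aBar m := by
  ext i
  cases i with
  -- The constant term is separate because for `m = 0` the upper index of `d m` is `-1`, not a
  -- natural number.
  | zero => simp [d, binom_zero_right]
  | succ i =>
    have h1 : (((m + 2 : ℕ) : ℤ) + (i + 1 : ℕ) - 1) / 2 = (((m + i) / 2 + 1 : ℕ) : ℤ) := by omega
    have h2 : ((m : ℤ) + (i + 1 : ℕ) - 1) / 2 = (((m + i) / 2 : ℕ) : ℤ) := by omega
    have h3 : ((m : ℤ) + i) / 2 = (((m + i) / 2 : ℕ) : ℤ) := by omega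
    have h4 : (i + 1 + 1) / 2 = i / 2 + 1 := by omega
    simp only [aBar, d, map_sub, coeff_mk, coeff_succ_X_mul, h1, h2, h3, h4, binom_natCast]
    rw [Nat.choose_succ_succ]
    push_cast
    ring

theorem aBar_zero : aBar 0 = 1 := by
  ext i
  rcases Nat.eq_zero_or_pos i with rfl | hi
  · simp [aBar, binom_zero_right]
  · simp only [aBar, coeff_mk, coeff_one, hi.ne', if_false]
    rw [binom_eq_zero_of_lt (by omega) (by omega), mul_zero]

theorem d_zero : d 0 = 1 := by
  ext i
  rcases Nat.eq_zero_or_pos i with rfl | hi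
  · simp [d, binom_zero_right]
  · simp only [d, coeff_mk, coeff_one, hi.ne', if_false]
    rw [binom_eq_zero_of_lt (by omega) (by omega), mul_zero]

theorem d_one : d 1 = 1 := by
  ext i
  rcases Nat.eq_zero_or_pos i with rfl | hi
  · simp [d, binom_zero_right]
  · simp only [d, coeff_mk, coeff_one, hi.ne', if_false]
    rw [binom_eq_zero_of_lt (by omega) (by omega), mul_zero]

theorem aBar_one : aBar 1 = 1 + X := by
  ext i
  rcases i with _ | _ | i
  · simp [aBar, binom_zero_right]
  · simp [aBar, binom, coeff_one]
  · simp only [aBar, coeff_mk, map_add, coeff_one, coeff_X]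
    rw [binom_eq_zero_of_lt (by omega) (by omega)]
    simp

/-- The left side is invariant under `m ↦ m + 1`: the two `X`-terms from the recurrences cancel. -/
theorem d_mul_d_add_aBar_mul_aBar (m : ℕ) :
    d (m + 2) * d (m + 1) + aBar (m + 1) * aBar m = 2 := by
  induction m with
  | zero =>
    rw [d_add_two, zero_add, aBar_one, aBar_zero, d_one, d_zero]
    ring
  | succ m ih =>
    rw [d_add_two (m + 1), aBar_add_two m]
    linear_combination ih

theorem aBar_succ_mul_d (m : ℕ) : aBar (m + 1) * d m = aBar m * d (m + 1) + X := by
  induction m with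
  | zero =>
    rw [zero_add, aBar_one, aBar_zero, d_one, d_zero]
    ring
  | succ m ih =>
    rw [aBar_add_two m]
    linear_combination (-1) * ih + X * d_mul_d_add_aBar_mul_aBar m - aBar (m + 1) * d_add_two m

theorem isUnit_d (m : ℕ) : IsUnit (d m) := by
  rw [isUnit_iff_constantCoeff, ← coeff_zero_eq_constantCoeff_apply]
  simp [d, binom_zero_right]

theorem a_mul_d_and_b_mul_d (m : ℕ) :
    a m * d m = X * aBar m ∧ b m * (d m * d (m + 1)) = X ^ 2 := by
  induction m with
  | zero => simp [a_zero, b_zero, d_zero, d_one, aBar_zero]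
  | succ m ih =>
    obtain ⟨ha, hb⟩ := ih
    have hd := isUnit_d m
    constructor
    -- After multiplication by `d m`, the claim is the cross-product identity `aBar_succ_mul_d`.
    · refine hd.mul_left_injective ?_
      dsimp only
      rw [a_succ]
      linear_combination d (m + 1) * ha + hb - X * aBar_succ_mul_d m
    · rw [d_add_two, ← hb, ← ha, ← b_succ_mul m]
      ring

theorem a_eq (m : ℕ) : a m = X * aBar m * Ring.inverse (d m) := by
  rw [← (a_mul_d_and_b_mul_d m).1, mul_assoc, Ring.mul_inverse_cancel _ (isUnit_d m), mul_one]

theorem b_eq (m : ℕ) : b m = X ^ 2 * Ring.inverse (d m * d (m + 1)) := by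
  rw [← (a_mul_d_and_b_mul_d m).2, mul_assoc,
    Ring.mul_inverse_cancel _ ((isUnit_d m).mul (isUnit_d (m + 1))), mul_one]

/-! ### Words, first letters and summability -/

/-- The empty word. -/
def Word.nil (n : ℕ) : Word n := ([] : List (Fin n))

/-- The word with first letter `k`, followed by `u`. -/
def Word.cons {n : ℕ} (k : Fin n) (u : Word n) : Word n := List.cons k u

theorem Word.induction {n : ℕ} {p : Word n → Prop} (nil : p (Word.nil n))
    (cons : ∀ k u, p u → p (Word.cons k u)) (u : Word n) : p u :=
  List.rec nil cons u

theorem Word.not_cons_le_nil {n : ℕ} (k : Fin n) (u : Word n) :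
    ¬ Word.cons k u ≤ Word.nil n := fun h =>
  Nat.not_succ_le_zero _ (Word.length_le h)

theorem Word.nil_le {n : ℕ} (w : Word n) : Word.nil n ≤ w :=
  ⟨[], List.Forall₂.nil, List.nil_sublist w⟩

/-- Greedy matching: using `c` for `k` whenever possible loses nothing, since `k u ≤ w` already
implies `u ≤ w`. -/
theorem Word.cons_le_cons_iff {n : ℕ} (k c : Fin n) (u w : Word n) :
    Word.cons k u ≤ Word.cons c w ↔ if k ≤ c then u ≤ w else Word.cons k u ≤ w := by
  have key : Word.cons k u ≤ Word.cons c w → Word.cons k u ≤ w ∨ k ≤ c ∧ u ≤ w := by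
    rw [Word.le_iff, Word.le_iff, Word.le_iff]
    intro h
    cases h with
    | cons h1 h2 => exact Or.inr ⟨h1, h2⟩
    | cons_right h => exact Or.inl h
  have htail : u ≤ Word.cons k u :=
    (Word.le_iff _ _).2 (List.tail_sublistForall₂_self (Rₐ := fun i j : Fin n => i ≤ j) (k :: u))
  split_ifs with hk
  · refine ⟨fun h => (key h).elim htail.trans And.right, fun h => ?_⟩
    exact (Word.le_iff _ _).2 (.cons hk ((Word.le_iff _ _).1 h))
  · refine ⟨fun h => (key h).elim id fun h' => absurd h'.1 hk, fun h => ?_⟩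
    exact (Word.le_iff _ _).2 (.cons_right ((Word.le_iff _ _).1 h))

theorem hasSum_list {α M : Type*} [Fintype α] [AddCommMonoid M] [TopologicalSpace M]
    [ContinuousAdd M] {F : List α → M} {s : α → M}
    (h : ∀ k, HasSum (fun w => F (k :: w)) (s k)) : HasSum F (F [] + ∑ k, s k) := by
  classical
  have h1 : ∀ k, HasSum (fun w : List α => if w.head? = some k then F w else 0) (s k) := by
    intro k
    rw [← (List.cons_injective (a := k)).hasSum_iff]
    · simpa [Function.comp_def] using h k
    · intro w hw
      rw [if_neg]
      cases w with
      | nil => simp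
      | cons c w =>
        intro e
        exact hw ⟨w, by simp_all⟩
  convert (hasSum_ite_eq ([] : List α) (F [])).add
    (hasSum_sum fun k (_ : k ∈ Finset.univ) => h1 k) using 1
  ext w
  cases w <;> simp

theorem Word.hasSum {n : ℕ} {M : Type*} [AddCommMonoid M] [TopologicalSpace M]
    [ContinuousAdd M] {F : Word n → M} {s : Fin n → M}
    (h : ∀ k, HasSum (fun w => F (Word.cons k w)) (s k)) :
    HasSum F (F (Word.nil n) + ∑ k, s k) :=
  hasSum_list h

/-- The words of length at most `N`. -/
noncomputable def shortWords (n N : ℕ) : Finset (Word n) :=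
  (List.finite_length_le (Fin n) N).toFinset

theorem mem_shortWords {n N : ℕ} {w : Word n} : w ∈ shortWords n N ↔ List.length w ≤ N :=
  (List.finite_length_le (Fin n) N).mem_toFinset

/-- Words longer than `N` do not reach the coefficient of `X ^ N`, so infinite sums become finite
ones. -/
theorem hasSum_coeff_sum_shortWords {n : ℕ} {R : Type*} [CommRing R] [TopologicalSpace R]
    {F : Word n → R⟦X⟧} (hF : ∀ w, X ^ List.length w ∣ F w) (N : ℕ) :
    HasSum (fun w => coeff N (F w)) (∑ w ∈ shortWords n N, coeff N (F w)) := by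
  refine hasSum_sum_of_ne_finset_zero fun w hw => ?_
  rw [mem_shortWords, not_le] at hw
  exact X_pow_dvd_iff.1 (hF w) N hw

theorem summable_of_X_pow_length_dvd {n : ℕ} {R : Type*} [CommRing R] [TopologicalSpace R]
    {F : Word n → R⟦X⟧} (hF : ∀ w, X ^ List.length w ∣ F w) : Summable F :=
  (WithPiTopology.summable_iff_summable_coeff R).2 fun N => (hasSum_coeff_sum_shortWords hF N).summable

theorem hasSum_iff_sum_shortWords {n : ℕ} {R : Type*} [CommRing R] [TopologicalSpace R]
    [T2Space R] {F : Word n → R⟦X⟧} (hF : ∀ w, X ^ List.length w ∣ F w) {s : R⟦X⟧} :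
    HasSum F s ↔ ∀ N, ∑ w ∈ shortWords n N, coeff N (F w) = coeff N s := by
  rw [WithPiTopology.hasSum_iff_hasSum_coeff]
  exact forall_congr' fun N => ⟨fun h => (hasSum_coeff_sum_shortWords hF N).unique h,
    fun h => h ▸ hasSum_coeff_sum_shortWords hF N⟩

/-! ### Weighted sums over upper sets and powers of zeta -/

/-- The product of the weights `c k` of the letters of a word. -/
def weight {n : ℕ} {R : Type*} [CommMonoid R] (c : Fin n → R) (w : Word n) : R :=
  (List.map c w).prod

theorem weight_nil {n : ℕ} {R : Type*} [CommMonoid R] (c : Fin n → R) :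
    weight c (Word.nil n) = 1 := rfl

theorem weight_cons {n : ℕ} {R : Type*} [CommMonoid R] (c : Fin n → R) (k : Fin n) (w : Word n) :
    weight c (Word.cons k w) = c k * weight c w :=
  List.prod_cons

theorem X_pow_length_dvd_weight {n : ℕ} {R : Type*} [CommRing R] {c : Fin n → R⟦X⟧}
    (hc : ∀ k, X ∣ c k) (w : Word n) : X ^ List.length w ∣ weight c w := by
  induction w using Word.induction with
  | nil => exact (pow_zero X).dvd.trans (one_dvd _)
  | cons k w ih =>
    rw [weight_cons]
    exact (pow_succ' X (List.length w)).dvd.trans (mul_dvd_mul (hc k) ih)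

theorem X_pow_norm {n : ℕ} {R : Type*} [CommRing R] (w : Word n) :
    (X : R⟦X⟧) ^ w.norm = weight (fun k : Fin n => X ^ ((k : ℕ) + 1)) w := by
  induction w using Word.induction with
  | nil => exact pow_zero X
  | cons k w ih =>
    rw [weight_cons, ← ih, ← pow_add]
    rfl

open scoped Classical in
theorem hasSum_weight_of_le {n : ℕ} {R : Type*} [CommRing R] [TopologicalSpace R] [T2Space R]
    [IsTopologicalRing R] {c : Fin n → R⟦X⟧} (hc : ∀ k, X ∣ c k) (u : Word n) :
    HasSum (fun w : Word n => if u ≤ w then weight c w else 0)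
      (weight (fun k => (∑ j with k ≤ j, c j) * Ring.inverse (1 - ∑ j with j < k, c j)) u *
        Ring.inverse (1 - ∑ j, c j)) := by
  have hs : ∀ u : Word n, Summable (fun w : Word n => if u ≤ w then weight c w else 0) := by
    refine fun u => summable_of_X_pow_length_dvd fun w => ?_
    split_ifs
    · exact X_pow_length_dvd_weight hc w
    · exact dvd_zero _
  induction u using Word.induction with
  | nil =>
    obtain ⟨T, h⟩ := hs (Word.nil n)
    have h' := Word.hasSum (F := fun w => if Word.nil n ≤ w then weight c w else 0)
      (s := fun k => c k * T) fun k => by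
        simpa [Word.nil_le, weight_cons] using h.mul_left (c k)
    have e := h.unique h'
    have hT : T * (1 - ∑ j, c j) = 1 := by
      rw [← Finset.sum_mul, if_pos (Word.nil_le _), weight_nil] at e
      linear_combination e
    convert h using 1
    have hu := isUnit_one_sub_of_X_dvd (Finset.dvd_sum (s := Finset.univ) fun j _ => hc j)
    rw [weight_nil, one_mul]
    linear_combination T * Ring.mul_inverse_cancel _ hu - Ring.inverse (1 - ∑ j, c j) * hT
  | cons k u ih =>
    set S := weight (fun k => (∑ j with k ≤ j, c j) * Ring.inverse (1 - ∑ j with j < k, c j)) u *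
        Ring.inverse (1 - ∑ j, c j) with hS
    obtain ⟨T, h⟩ := hs (Word.cons k u)
    have h' := Word.hasSum (F := fun w => if Word.cons k u ≤ w then weight c w else 0)
      (s := fun j => c j * if k ≤ j then S else T) fun j => by
        by_cases hj : k ≤ j
        · simpa [Word.cons_le_cons_iff, hj, weight_cons] using ih.mul_left (c j)
        · simpa [Word.cons_le_cons_iff, hj, weight_cons] using h.mul_left (c j)
    have e := h.unique h'
    -- A first letter `j ≥ k` absorbs `k` and leaves the sum `S` for `u`; a letter `j < k` leaves
    -- `T` itself.
    have hT : T * (1 - ∑ j with j < k, c j) = (∑ j with k ≤ j, c j) * S := by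
      rw [if_neg (Word.not_cons_le_nil k u), zero_add] at e
      simp only [mul_ite, Finset.sum_ite, ← Finset.sum_mul, not_le] at e
      linear_combination e
    convert h using 1
    have hu := isUnit_one_sub_of_X_dvd
      (Finset.dvd_sum (s := Finset.univ.filter (fun j => j < k)) fun j _ => hc j)
    refine hu.mul_left_injective ?_
    dsimp only
    rw [hT, hS, weight_cons]
    linear_combination (∑ j with k ≤ j, c j) * S * Ring.inverse_mul_cancel _ hu

/-- Replacing the interval by a set independent of `u` and `w` makes the sums over `v` and `w`
interchangeable. -/
theorem zeta_pow_succ_apply {n N : ℕ} (m : ℕ) (u : Word n) {w : Word n}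
    (hw : w ∈ shortWords n N) :
    (zeta n ^ (m + 1)) u w = ∑ v ∈ shortWords n N, zeta n u v * (zeta n ^ m) v w := by
  rw [pow_succ', IncidenceAlgebra.mul_apply]
  refine Finset.sum_subset (fun v hv => ?_) fun v _ hv => ?_
  · exact mem_shortWords.2 ((Word.length_le (Finset.mem_Icc.1 hv).2).trans (mem_shortWords.1 hw))
  · rw [Finset.mem_Icc, not_and_or] at hv
    rcases hv with hv | hv
    · rw [IncidenceAlgebra.apply_eq_zero_of_not_le hv, zero_mul]
    · rw [IncidenceAlgebra.apply_eq_zero_of_not_le hv, mul_zero]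

theorem hasSum_zeta_pow (m : ℕ) (u : Word 2) :
    HasSum (fun w : Word 2 => C ((zeta 2 ^ m) u w) * (X : ℤ⟦X⟧) ^ w.norm)
      (weight ![a m, b m] u * ∏ i ∈ Finset.range m, Ring.inverse (1 - a i - b i)) := by
  classical
  have hd : ∀ (m : ℕ) (u w : Word 2),
      X ^ List.length w ∣ C ((zeta 2 ^ m) u w) * (X : ℤ⟦X⟧) ^ w.norm := fun m u w => by
    rw [X_pow_norm]
    exact (X_pow_length_dvd_weight (fun k => dvd_pow_self X k.1.succ_ne_zero) w).mul_left _
  induction m generalizing u with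
  | zero =>
    convert hasSum_single (f := fun w : Word 2 => C ((zeta 2 ^ 0) u w) * (X : ℤ⟦X⟧) ^ w.norm) u
      fun w hw => ?_ using 1
    · rw [X_pow_norm, a_zero, b_zero]
      have : (![X, X ^ 2] : Fin 2 → ℤ⟦X⟧) = fun k : Fin 2 => X ^ ((k : ℕ) + 1) := by
        ext1 k
        fin_cases k <;> simp
      simp [this]
    · simp [hw.symm]
  | succ m ih =>
    set c : Fin 2 → ℤ⟦X⟧ := ![a m, b m]
    have hc : ∀ k, X ∣ c k := by
      rw [Fin.forall_fin_two]
      exact X_dvd_a_and_b m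
    set P := ∏ i ∈ Finset.range m, Ring.inverse (1 - a i - b i) with hP
    have key := (hasSum_weight_of_le hc u).mul_right P
    have himage : (fun k => (∑ j with k ≤ j, c j) * Ring.inverse (1 - ∑ j with j < k, c j)) =
        ![a (m + 1), b (m + 1)] := by
      ext1 k
      fin_cases k
      · simp [c, a_succ]
      · simp [c, b_succ, Finset.sum_filter]
    rw [himage, mul_assoc, mul_comm (Ring.inverse _), Fin.sum_univ_two, ← sub_sub, hP,
      show c 0 = a m from rfl, show c 1 = b m from rfl, ← Finset.prod_range_succ] at key
    replace key := (hasSum_iff_sum_shortWords fun w => by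
      split_ifs
      · exact (X_pow_length_dvd_weight hc w).mul_right _
      · simp).1 key
    refine (hasSum_iff_sum_shortWords (hd (m + 1) u)).2 fun N => ?_
    rw [← key N]
    calc
      _ = ∑ w ∈ shortWords 2 N, ∑ v ∈ shortWords 2 N,
          zeta 2 u v * coeff N (C ((zeta 2 ^ m) v w) * (X : ℤ⟦X⟧) ^ w.norm) := by
        refine Finset.sum_congr rfl fun w hw => ?_
        simp only [zeta_pow_succ_apply m u hw, coeff_C_mul, Finset.sum_mul, mul_assoc]
      _ = _ := by
        rw [Finset.sum_comm]
        refine Finset.sum_congr rfl fun v _ => ?_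
        rw [← Finset.mul_sum, (hasSum_iff_sum_shortWords (hd m v)).1 (ih v) N]
        by_cases h : u ≤ v <;> simp [zeta, h, hP]

theorem weight_eq_of_type_eq {R : Type*} [CommMonoid R] (p q : R) {u : Word 2} {l₁ l₂ : ℕ}
    (h : u.type = ![l₁, l₂]) : weight ![p, q] u = p ^ l₁ * q ^ l₂ := by
  have h0 : List.count 0 u = l₁ := congrFun h 0
  have h1 : List.count 1 u = l₂ := congrFun h 1
  have key (w : List (Fin 2)) :
      (List.map ![p, q] w).prod = p ^ List.count 0 w * q ^ List.count 1 w := by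
    rw [Finset.prod_list_map_count, Finset.prod_subset (Finset.subset_univ _), Fin.prod_univ_two]
    · rfl
    · intro k _ hk
      rw [List.count_eq_zero.2 (by simpa using hk), pow_zero]
  rw [← h0, ← h1]
  exact key u

end CompPoset

theorem mainTheorem6 :
    (∀ (u : CompPoset.Word 2) (l₁ l₂ : ℕ), u.type = ![l₁, l₂] → ∀ m : ℕ,
      (∀ i < m, IsUnit (1 - CompPoset.a i - CompPoset.b i)) ∧
      HasSum
        (fun w : CompPoset.Word 2 =>
          PowerSeries.C ((CompPoset.zeta 2 ^ m) u w) * (PowerSeries.X : PowerSeries ℤ) ^ w.norm)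
        (CompPoset.a m ^ l₁ * CompPoset.b m ^ l₂ *
          ∏ i ∈ Finset.range m, Ring.inverse (1 - CompPoset.a i - CompPoset.b i))) ∧
    (∀ m : ℕ,
      IsUnit (CompPoset.d m) ∧
      CompPoset.a m =
        PowerSeries.X * CompPoset.aBar m * Ring.inverse (CompPoset.d m) ∧
      CompPoset.b m =
        PowerSeries.X ^ 2 * Ring.inverse (CompPoset.d m * CompPoset.d (m + 1))) := by
  refine ⟨fun u l₁ l₂ hu m => ⟨fun i _ => ?_, ?_⟩,
    fun m => ⟨CompPoset.isUnit_d m, CompPoset.a_eq m, CompPoset.b_eq m⟩⟩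
  · rw [sub_sub]
    have h := CompPoset.X_dvd_a_and_b i
    exact CompPoset.isUnit_one_sub_of_X_dvd (dvd_add h.1 h.2)
  · rw [← CompPoset.weight_eq_of_type_eq _ _ hu]
    exact CompPoset.hasSum_zeta_pow m u
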